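/- Let $1\le k\le n$, and let $\mathbb M(n)$ be the space of $n\times n$ complex matrices. For $A\in\mathbb M(n)$ let $s_1(A)\ge s_2(A)\ge\cdots\ge s_n(A)\ge 0$ be the singular values of $A$, and let $g(A)=\|A\|_{(k)}=s_1(A)+\cdots+s_k(A)$ be its Ky Fan $k$-norm. The subdifferential $\partial g(A)$ is the set of linear functionals $\varphi$ on $\mathbb M(n)$ such that $g(Y)-g(A)\ge \operatorname{Re}\varphi(Y-A)$ for all $Y\in\mathbb M(n)$; the functional $X\mapsto\operatorname{tr}(G^*X)$ is identified with the matrix $G\in\mathbb M(n)$, so that $\partial g(A)\subseteq\mathbb M(n)$. Theorem. For every $A\in\mathbb M(n)$, $$\partial g(A)=\operatorname{conv}\Big\{\sum_{i=1}^k u_iv_i^* : u_1,\dots,u_k\in\mathbb C^n \text{ orthonormal},\ v_1,\dots,v_k\in\mathbb C^n \text{ orthonormal},\ Av_i=s_i(A)u_i \text{ for all } 1\le i\le k\Big\}$$ $$\phantom{\partial g(A)}=\operatorname{conv}\Big\{\sum_{i=1}^k u_iv_i^* : u_1,\dots,u_k\in\mathbb C^n \text{ orthonormal},\ v_1,\dots,v_k\in\mathbb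 C^n \text{ orthonormal},\ Av_i=s_i(A)u_i \text{ and } A^*u_i=s_i(A)v_i \text{ for all } 1\le i\le k\Big\}.$$ -/

import Mathlib

open scoped Matrix ComplexConjugate

noncomputable section

/-- The subdifferential of `f : X → ℝ` at `a`: the set of continuous complex-linear functionals `φ`
on `X` with `f y - f a ≥ Re φ (y - a)` for all `y`. -/
def subdifferential {X : Type*} [AddCommGroup X] [Module ℂ X] [TopologicalSpace X]
    (f : X → ℝ) (a : X) : Set (X →L[ℂ] ℂ) :=
  {φ | ∀ y : X, f y - f a ≥ (φ (y - a)).re}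

/-- The singular values of a square complex matrix, `0`-indexed: `singVal A 0 ≥ singVal A 1 ≥ ⋯`,
so that `singVal A i` is the usual `s_{i+1}(A)`. -/
def singVal {n : ℕ} (A : Matrix (Fin n) (Fin n) ℂ) (i : ℕ) : ℝ :=
  (Matrix.toEuclideanLin A).singularValues i

/-- The Ky Fan `k`-norm: the sum of the `k` largest singular values. -/
def kyFanNorm {n : ℕ} (k : ℕ) (A : Matrix (Fin n) (Fin n) ℂ) : ℝ :=
  ∑ i ∈ Finset.range k, singVal A i

/-- The functional `X ↦ tr (G* X)` on the space of matrices. -/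
def traceFunctional {n : ℕ} (G : Matrix (Fin n) (Fin n) ℂ) :
    Matrix (Fin n) (Fin n) ℂ →L[ℂ] ℂ where
  toFun X := (Gᴴ * X).trace
  map_add' X Y := by rw [Matrix.mul_add, Matrix.trace_add]
  map_smul' c X := by rw [Matrix.mul_smul, Matrix.trace_smul]; rfl
  cont := by fun_prop

theorem traceFunctional_single {n : ℕ} (G : Matrix (Fin n) (Fin n) ℂ) (i j : Fin n) :
    traceFunctional G (Matrix.single i j 1) = conj (G i j) := by
  simp [traceFunctional, Matrix.trace_mul_single]

/-- The standard identification of the space of matrices with its dual: the conjugate-linear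
bijection which sends `G` to the functional `X ↦ tr (G* X)`. -/
def traceDual (n : ℕ) :
    Matrix (Fin n) (Fin n) ℂ ≃ₗ⋆[ℂ] (Matrix (Fin n) (Fin n) ℂ →L[ℂ] ℂ) where
  toFun := traceFunctional
  map_add' G H := by
    ext X
    simp [traceFunctional, Matrix.add_mul]
  map_smul' c G := by
    ext X
    simp [traceFunctional]
  invFun φ := Matrix.of fun i j => conj (φ (Matrix.single i j 1))
  left_inv G := by
    ext i j
    simp [traceFunctional_single]
  right_inv φ := by
    have h : (traceFunctional (Matrix.of fun i j => conj (φ (Matrix.single i j 1)))).toLinearMap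
        = φ.toLinearMap := by
      refine Matrix.ext_linearMap ℂ fun i j => LinearMap.ext_ring ?_
      have := traceFunctional_single (Matrix.of fun i j => conj (φ (Matrix.single i j 1))) i j
      rw [Matrix.of_apply, Complex.conj_conj] at this
      exact this
    exact ContinuousLinearMap.coe_injective h

/-- The matrix `∑ i, u_i v_i*`. -/
def sumOuter {n k : ℕ} (u v : Fin k → EuclideanSpace ℂ (Fin n)) : Matrix (Fin n) (Fin n) ℂ :=
  ∑ i, Matrix.vecMulVec (u i).ofLp (star (v i).ofLp)

end

open Module InnerProductSpace Filter Topology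

/-! For orthonormal `u`, `v` the Ky Fan maximum principle gives `Re tr(G* Y) ≤ g(Y)` with `G = ∑
uᵢvᵢ*`, and equality holds at `A` as soon as `A vᵢ = sᵢ uᵢ`. So every generator is a subgradient,
and convexity gives the hull.

Conversely, let `φ` be a subgradient and `X` a direction. A singular frame of `A + tX`, `t > 0`,
yields `G` with `g(A + tX) = Re tr(G*(A + tX)) ≤ g(A) + t Re tr(G* X)`, hence `Re φ(X) ≤ Re tr(G*
X)`. As `t → 0` the frames accumulate at a two-sided singular frame of `A`. The hull of these
generators is compact, so Hahn–Banach puts `φ` in it. The one-sided hull lies between the two-sided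
hull and the subdifferential, so all three agree. -/

/-- The convex hull of a compact set in a finite-dimensional space is compact. -/
theorem IsCompact.convexHull_of_finiteDimensional {E : Type*} [AddCommGroup E] [Module ℝ E]
    [TopologicalSpace E] [ContinuousAdd E] [ContinuousSMul ℝ E] [FiniteDimensional ℝ E]
    {s : Set E} (hs : IsCompact s) : IsCompact (convexHull ℝ s) := by
  classical
  rcases s.eq_empty_or_nonempty with rfl | ⟨x₀, hx₀⟩
  · simp
  -- Carathéodory: `dim E + 1` points suffice, so the hull is a continuous image of a compact
  -- product. Shorter combinations are padded with weight `0` at `x₀`.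
  set N := finrank ℝ E + 1
  have key : convexHull ℝ s = (fun p : (Fin N → ℝ) × (Fin N → E) => ∑ i, p.1 i • p.2 i) ''
      (stdSimplex ℝ (Fin N) ×ˢ Set.univ.pi fun _ => s) := by
    apply Set.Subset.antisymm
    · intro x hx
      obtain ⟨ι, _, z, w, hz, hind, hw, hw1, rfl⟩ := eq_pos_convex_span_of_mem_convexHull hx
      have hcard : Fintype.card ι ≤ Fintype.card (Fin N) := by
        rw [Fintype.card_fin]
        exact hind.card_le_finrank_succ.trans (Nat.succ_le_succ (Submodule.finrank_le _))
      obtain ⟨e⟩ := Function.Embedding.nonempty_of_card_le hcard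
      refine ⟨(Function.extend e w 0, Function.extend e z fun _ => x₀), ⟨⟨fun i => ?_, ?_⟩, ?_⟩, ?_⟩
      · by_cases hi : ∃ j, e j = i
        · obtain ⟨j, rfl⟩ := hi
          simpa [e.injective.extend_apply] using (hw j).le
        · simp [Function.extend_apply' _ _ _ hi]
      · rw [← hw1]
        refine (Fintype.sum_of_injective e e.injective _ _ (fun i hi => ?_) fun i => ?_).symm
        · simp [Function.extend_apply' w _ _ (by simpa using hi)]
        · simp [e.injective.extend_apply]
      · rintro i -
        by_cases hi : ∃ j, e j = i
        · obtain ⟨j, rfl⟩ := hi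
          simpa [e.injective.extend_apply] using hz ⟨j, rfl⟩
        · simpa [Function.extend_apply' _ _ _ hi] using hx₀
      · refine (Fintype.sum_of_injective e e.injective _ _ (fun i hi => ?_) fun i => ?_).symm
        · simp [Function.extend_apply' w _ _ (by simpa using hi)]
        · simp [e.injective.extend_apply]
    · rintro _ ⟨⟨w, z⟩, ⟨⟨hw, hw1⟩, hz⟩, rfl⟩
      exact (convex_convexHull ℝ s).sum_mem (fun i _ => hw i) hw1
        fun i _ => subset_convexHull ℝ s (hz i trivial)
  rw [key]
  exact ((isCompact_stdSimplex ℝ _).prod (isCompact_univ_pi fun _ => hs)).image (by fun_prop)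

/-! ### Singular value decomposition and the Ky Fan maximum principle -/

section SVD

variable {𝕜 E : Type*} [RCLike 𝕜] [NormedAddCommGroup E] [InnerProductSpace 𝕜 E]
  [FiniteDimensional 𝕜 E]

/-- The singular value decomposition of an endomorphism. -/
theorem LinearMap.exists_orthonormalBasis_singularValues {n : ℕ} (hn : finrank 𝕜 E = n)
    (T : E →ₗ[𝕜] E) :
    ∃ b c : OrthonormalBasis (Fin n) 𝕜 E, ∀ i,
      T (b i) = (T.singularValues i : 𝕜) • c i ∧
        T.adjoint (c i) = (T.singularValues i : 𝕜) • b i := by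
  classical
  set b := T.isSymmetric_adjoint_comp_self.eigenvectorBasis hn with hb
  have hTT (i) : T.adjoint (T (b i)) = ((T.singularValues i ^ 2 : ℝ) : 𝕜) • b i := by
    rw [T.sq_singularValues_fin hn]
    exact T.isSymmetric_adjoint_comp_self.apply_eigenvectorBasis hn i
  have hin (i j) : inner 𝕜 (T (b i)) (T (b j)) =
      if i = j then ((T.singularValues j ^ 2 : ℝ) : 𝕜) else 0 := by
    rw [← LinearMap.adjoint_inner_right, hTT, inner_smul_right,
      orthonormal_iff_ite.1 b.orthonormal]
    simp
  -- The normalized nonzero images `T (b i)` are orthonormal; any completion to a basis works, since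
  -- `T (b i) = 0` at the other indices.
  obtain ⟨c, hc⟩ := Orthonormal.exists_orthonormalBasis_extension_of_card_eq (𝕜 := 𝕜)
    (ι := Fin n) (by simpa using hn)
    (v := fun i => ((T.singularValues i : 𝕜))⁻¹ • T (b i)) (s := {i | T.singularValues i ≠ 0}) (by
      rw [orthonormal_iff_ite]
      rintro ⟨i, hi⟩ ⟨j, hj⟩
      have hj' : (T.singularValues j : 𝕜) ≠ 0 := by simpa using hj
      simp only [Set.domRestrict_apply, inner_smul_left, inner_smul_right, hin, Subtype.mk.injEq]
      split_ifs with h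
      · subst h
        simp
        field_simp
      · simp)
  have hT (i) : T (b i) = (T.singularValues i : 𝕜) • c i := by
    by_cases hi : T.singularValues i = 0
    · have := hin i i
      simpa [hi] using this
    · rw [hc i hi, smul_inv_smul₀ (by simpa using hi)]
  refine ⟨b, c, fun i => ⟨hT i, ext_inner_left_basis b.toBasis fun j => ?_⟩⟩
  rw [b.coe_toBasis, LinearMap.adjoint_inner_right, hT, inner_smul_left, inner_smul_right,
    orthonormal_iff_ite.1 b.orthonormal, orthonormal_iff_ite.1 c.orthonormal]
  by_cases h : j = i <;> simp [h]

/-- The Ky Fan maximum principle: the sum of the `k` largest singular values of `T` dominates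
`Re ∑ i, ⟪u i, T (v i)⟫` for orthonormal families `u`, `v` of length `k`. -/
theorem LinearMap.re_sum_inner_le_sum_singularValues {k : ℕ} (T : E →ₗ[𝕜] E) {u v : Fin k → E}
    (hu : Orthonormal 𝕜 u) (hv : Orthonormal 𝕜 v) :
    RCLike.re (∑ i, inner 𝕜 (u i) (T (v i))) ≤ ∑ j ∈ Finset.range k, T.singularValues j := by
  obtain ⟨n, hn⟩ : ∃ n, finrank 𝕜 E = n := ⟨_, rfl⟩
  have hkn : k ≤ n := by
    simpa [hn] using hu.linearIndependent.fintype_card_le_finrank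
  obtain ⟨b, c, hbc⟩ := T.exists_orthonormalBasis_singularValues hn
  set s : Fin n → ℝ := fun j => T.singularValues j
  -- Weights from `Re(xy) ≤ (|x|² + |y|²)/2`. Bessel gives `d j ≤ 1`, Parseval gives total mass `k`.
  set d : Fin n → ℝ := fun j =>
    ((∑ i, ‖inner 𝕜 (v i) (b j)‖ ^ 2) + ∑ i, ‖inner 𝕜 (u i) (c j)‖ ^ 2) / 2 with hd
  have hexp (i) : inner 𝕜 (u i) (T (v i)) =
      ∑ j, (s j : 𝕜) * (inner 𝕜 (b j) (v i) * inner 𝕜 (u i) (c j)) := by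
    conv_lhs => rw [← b.sum_repr' (v i)]
    simp only [map_sum, map_smul, (hbc _).1, inner_sum, inner_smul_right]
    exact Finset.sum_congr rfl fun j _ => by ring
  have h1 : RCLike.re (∑ i, inner 𝕜 (u i) (T (v i))) ≤ ∑ j, s j * d j := by
    simp only [hexp, map_sum, RCLike.re_ofReal_mul, hd]
    rw [Finset.sum_comm]
    refine Finset.sum_le_sum fun j _ => ?_
    rw [← Finset.mul_sum, ← Finset.sum_add_distrib, Finset.sum_div]
    refine mul_le_mul_of_nonneg_left (Finset.sum_le_sum fun i _ => ?_)
      (T.singularValues_nonneg j)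
    refine (RCLike.re_le_norm _).trans ?_
    rw [norm_mul, norm_inner_symm (b j)]
    nlinarith [sq_nonneg (‖inner 𝕜 (v i) (b j)‖ - ‖inner 𝕜 (u i) (c j)‖)]
  have hd0 (j) : 0 ≤ d j := by positivity
  have hd1 (j) : d j ≤ 1 := by
    have h2 := hv.sum_inner_products_le (b j) (s := Finset.univ)
    have h3 := hu.sum_inner_products_le (c j) (s := Finset.univ)
    simp only [b.orthonormal.1, c.orthonormal.1] at h2 h3
    simp only [hd]
    linarith
  have hdk : ∑ j, d j = k := by
    simp only [hd]
    rw [← Finset.sum_div, Finset.sum_add_distrib, Finset.sum_comm, Finset.sum_comm (γ := Fin n)]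
    simp [b.sum_sq_norm_inner_left, c.sum_sq_norm_inner_left, hu.1, hv.1]
  set e : Fin n → ℝ := fun j => if (j : ℕ) < k then 1 else 0
  have hrange (f : ℕ → ℝ) : ∑ j : Fin n, f j * e j = ∑ j ∈ Finset.range k, f j := by
    rw [Fin.sum_univ_eq_sum_range fun j => f j * if j < k then 1 else 0]
    simp only [mul_ite, mul_one, mul_zero]
    rw [← Finset.sum_filter]
    congr 1
    ext j
    simp
    omega
  have hek : ∑ j, e j = k := by simpa using hrange fun _ => 1
  -- The factors have opposite signs on either side of the threshold `k`. Subtracting the constant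
  -- costs nothing because `d` and `e` have equal mass.
  have h4 : ∑ j, (s j - T.singularValues k) * (d j - e j) ≤ 0 := by
    refine Finset.sum_nonpos fun j _ => ?_
    by_cases hj : (j : ℕ) < k
    · have := T.singularValues_antitone hj.le
      have := hd1 j
      simp only [e, hj, if_true, s]
      exact mul_nonpos_of_nonneg_of_nonpos (by linarith) (by linarith)
    · have := T.singularValues_antitone (not_lt.1 hj)
      have := hd0 j
      simp only [e, hj, if_false, s]
      exact mul_nonpos_of_nonpos_of_nonneg (by linarith) (by linarith)
  have h5 : ∑ j, (s j - T.singularValues k) * (d j - e j) =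
      ∑ j, s j * d j - ∑ j, s j * e j - T.singularValues k * (∑ j, d j - ∑ j, e j) := by
    rw [← Finset.sum_sub_distrib, ← Finset.sum_sub_distrib, Finset.mul_sum,
      ← Finset.sum_sub_distrib]
    exact Finset.sum_congr rfl fun j _ => by ring
  rw [h5, hdk, hek, hrange fun j => T.singularValues j] at h4
  linarith

end SVD

/-! ### The trace pairing with `∑ uᵢvᵢ*` -/

theorem traceFunctional_sumOuter {n k : ℕ} (u v : Fin k → EuclideanSpace ℂ (Fin n))
    (X : Matrix (Fin n) (Fin n) ℂ) :
    traceFunctional (sumOuter u v) X = ∑ i, inner ℂ (u i) (Matrix.toEuclideanLin X (v i)) := by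
  change ((sumOuter u v)ᴴ * X).trace = _
  simp only [sumOuter, Matrix.conjTranspose_sum, Finset.sum_mul, Matrix.trace_sum,
    Matrix.conjTranspose_vecMulVec, star_star, Matrix.vecMulVec_mul, Matrix.trace_vecMulVec]
  refine Finset.sum_congr rfl fun i _ => ?_
  rw [EuclideanSpace.inner_eq_star_dotProduct, Matrix.toLpLin_apply, dotProduct_comm,
    ← Matrix.dotProduct_mulVec, dotProduct_comm]

/-- The real part of the trace pairing is a real inner product. Symmetry lets `G`, on which the
pairing depends conjugate-linearly, become the linear argument. -/
theorem re_traceFunctional_comm {n : ℕ} (G H : Matrix (Fin n) (Fin n) ℂ) :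
    (traceFunctional G H).re = (traceFunctional H G).re := by
  change ((Gᴴ * H).trace).re = ((Hᴴ * G).trace).re
  rw [← Complex.conj_re, starRingEnd_apply, ← Matrix.trace_conjTranspose]
  simp

theorem traceFunctional_sumOuter_re_le {n k : ℕ} {u v : Fin k → EuclideanSpace ℂ (Fin n)}
    (hu : Orthonormal ℂ u) (hv : Orthonormal ℂ v) (X : Matrix (Fin n) (Fin n) ℂ) :
    (traceFunctional (sumOuter u v) X).re ≤ kyFanNorm k X := by
  rw [traceFunctional_sumOuter]
  exact LinearMap.re_sum_inner_le_sum_singularValues _ hu hv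

theorem traceFunctional_sumOuter_self {n k : ℕ} {u v : Fin k → EuclideanSpace ℂ (Fin n)}
    (hu : Orthonormal ℂ u) {X : Matrix (Fin n) (Fin n) ℂ}
    (h : ∀ i, Matrix.toEuclideanLin X (v i) = (singVal X i : ℂ) • u i) :
    (traceFunctional (sumOuter u v) X).re = kyFanNorm k X := by
  rw [traceFunctional_sumOuter, kyFanNorm, ← Fin.sum_univ_eq_sum_range, Complex.re_sum]
  refine Finset.sum_congr rfl fun i _ => ?_
  rw [h, inner_smul_right, orthonormal_iff_ite.1 hu]
  simp

/-! ### Compactness and closedness of singular frames -/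

/-- The pairs of orthonormal families of left and right singular vectors for the `k` largest
singular values of `A`. -/
def singularFrames {n : ℕ} (k : ℕ) (A : Matrix (Fin n) (Fin n) ℂ) :
    Set ((Fin k → EuclideanSpace ℂ (Fin n)) × (Fin k → EuclideanSpace ℂ (Fin n))) :=
  {p | Orthonormal ℂ p.1 ∧ Orthonormal ℂ p.2 ∧
    (∀ i, Matrix.toEuclideanLin A (p.2 i) = (singVal A i : ℂ) • p.1 i) ∧
    ∀ i, Matrix.toEuclideanLin Aᴴ (p.1 i) = (singVal A i : ℂ) • p.2 i}

theorem singularFrames_nonempty {n k : ℕ} (hkn : k ≤ n) (A : Matrix (Fin n) (Fin n) ℂ) :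
    (singularFrames k A).Nonempty := by
  obtain ⟨b, c, h⟩ := (Matrix.toEuclideanLin A).exists_orthonormalBasis_singularValues
    (n := n) (by simp)
  refine ⟨(c ∘ Fin.castLE hkn, b ∘ Fin.castLE hkn),
    c.orthonormal.comp _ (Fin.castLE_injective hkn),
    b.orthonormal.comp _ (Fin.castLE_injective hkn), fun i => ?_, fun i => ?_⟩
  · exact (h (Fin.castLE hkn i)).1
  · rw [Matrix.toEuclideanLin_conjTranspose_eq_adjoint]
    exact (h (Fin.castLE hkn i)).2

theorem isCompact_setOf_orthonormal {𝕜 E ι : Type*} [RCLike 𝕜] [NormedAddCommGroup E]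
    [InnerProductSpace 𝕜 E] [FiniteDimensional 𝕜 E] [Fintype ι] :
    IsCompact {v : ι → E | Orthonormal 𝕜 v} := by
  classical
  have := FiniteDimensional.proper_rclike 𝕜 E
  refine (isCompact_univ_pi fun _ : ι => isCompact_sphere (0 : E) 1).of_isClosed_subset ?_
    fun v hv i _ => by simpa using hv.1 i
  simp only [orthonormal_iff_ite, Set.ofPred_forall]
  exact isClosed_iInter fun i => isClosed_iInter fun j =>
    isClosed_eq (by fun_prop) continuous_const

/-- A frame attaining the norm of `B` is a competitor for `A`; each of its `k` terms contributes at
most the operator norm. -/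
theorem kyFanNorm_sub_le {n k : ℕ} (hkn : k ≤ n) (A B : Matrix (Fin n) (Fin n) ℂ) :
    kyFanNorm k B - kyFanNorm k A ≤ k * ‖Matrix.toEuclideanCLM (𝕜 := ℂ) (B - A)‖ := by
  obtain ⟨⟨u, v⟩, hu, hv, h, -⟩ := singularFrames_nonempty hkn B
  rw [← traceFunctional_sumOuter_self hu h]
  refine (sub_le_sub_left (traceFunctional_sumOuter_re_le hu hv A) _).trans ?_
  rw [← Complex.sub_re, ← map_sub, traceFunctional_sumOuter, Complex.re_sum]
  refine (Finset.sum_le_card_nsmul _ _ ‖Matrix.toEuclideanCLM (𝕜 := ℂ) (B - A)‖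
    fun i _ => ?_).trans_eq (by simp)
  refine (Complex.re_le_norm _).trans ((norm_inner_le_norm _ _).trans ?_)
  rw [hu.1, one_mul]
  simpa [hv.1] using! (Matrix.toEuclideanCLM (𝕜 := ℂ) (B - A)).le_opNorm (v i)

theorem continuous_kyFanNorm {n k : ℕ} (hkn : k ≤ n) :
    Continuous (kyFanNorm k : Matrix (Fin n) (Fin n) ℂ → ℝ) := by
  have hc : Continuous fun X : Matrix (Fin n) (Fin n) ℂ => Matrix.toEuclideanCLM (𝕜 := ℂ) X :=
    (Matrix.toEuclideanCLM (n := Fin n)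
      (𝕜 := ℂ)).toAlgEquiv.toLinearMap.continuous_of_finiteDimensional
  refine continuous_iff_continuousAt.2 fun A => ?_
  rw [ContinuousAt, tendsto_iff_norm_sub_tendsto_zero]
  refine squeeze_zero (g := fun B : Matrix (Fin n) (Fin n) ℂ => k * ‖Matrix.toEuclideanCLM (𝕜 := ℂ) (B - A)‖)
    (fun _ => norm_nonneg _) (fun B => abs_sub_le_iff.2 ⟨kyFanNorm_sub_le hkn A B, ?_⟩) ?_
  · have := kyFanNorm_sub_le hkn B A
    rwa [← neg_sub B A, map_neg, norm_neg] at this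
  · have : Continuous fun B : Matrix (Fin n) (Fin n) ℂ => k * ‖Matrix.toEuclideanCLM (𝕜 := ℂ) (B - A)‖ := by fun_prop
    simpa using this.tendsto A

theorem continuous_singVal {n i : ℕ} (hi : i < n) :
    Continuous fun A : Matrix (Fin n) (Fin n) ℂ => singVal A i := by
  have h (A : Matrix (Fin n) (Fin n) ℂ) : singVal A i = kyFanNorm (i + 1) A - kyFanNorm i A := by
    simp [kyFanNorm, Finset.sum_range_succ]
  simp only [h]
  exact (continuous_kyFanNorm hi).sub (continuous_kyFanNorm hi.le)

theorem Continuous.toEuclideanLin_apply {X : Type*} [TopologicalSpace X] {n : ℕ}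
    {f : X → Matrix (Fin n) (Fin n) ℂ} {g : X → EuclideanSpace ℂ (Fin n)} (hf : Continuous f)
    (hg : Continuous g) : Continuous fun x => Matrix.toEuclideanLin (f x) (g x) := by
  simp only [Matrix.toLpLin_apply]
  fun_prop

/-- The relation `p ∈ singularFrames k A` is closed in the pair `(A, p)`. -/
theorem isClosed_setOf_mem_singularFrames {n k : ℕ} (hkn : k ≤ n) :
    IsClosed {q : Matrix (Fin n) (Fin n) ℂ ×
      ((Fin k → EuclideanSpace ℂ (Fin n)) × (Fin k → EuclideanSpace ℂ (Fin n))) |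
        q.2 ∈ singularFrames k q.1} := by
  have ho := (isCompact_setOf_orthonormal (𝕜 := ℂ) (E := EuclideanSpace ℂ (Fin n))
    (ι := Fin k)).isClosed
  have hmem (q : Matrix (Fin n) (Fin n) ℂ ×
      ((Fin k → EuclideanSpace ℂ (Fin n)) × (Fin k → EuclideanSpace ℂ (Fin n)))) :
      q.2 ∈ singularFrames k q.1 ↔ Orthonormal ℂ q.2.1 ∧ Orthonormal ℂ q.2.2 ∧
        (∀ i, Matrix.toEuclideanLin q.1 (q.2.2 i) = (singVal q.1 i : ℂ) • q.2.1 i) ∧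
        ∀ i, Matrix.toEuclideanLin q.1ᴴ (q.2.1 i) = (singVal q.1 i : ℂ) • q.2.2 i := Iff.rfl
  simp only [hmem, Set.ofPred_and, Set.ofPred_forall]
  have hu : Continuous fun q : Matrix (Fin n) (Fin n) ℂ ×
      ((Fin k → EuclideanSpace ℂ (Fin n)) × (Fin k → EuclideanSpace ℂ (Fin n))) => q.2.1 :=
    continuous_fst.comp continuous_snd
  have hv : Continuous fun q : Matrix (Fin n) (Fin n) ℂ ×
      ((Fin k → EuclideanSpace ℂ (Fin n)) × (Fin k → EuclideanSpace ℂ (Fin n))) => q.2.2 :=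
    continuous_snd.comp continuous_snd
  have hs (i : Fin k) : Continuous fun q : Matrix (Fin n) (Fin n) ℂ ×
      ((Fin k → EuclideanSpace ℂ (Fin n)) × (Fin k → EuclideanSpace ℂ (Fin n))) =>
        (singVal q.1 i : ℂ) :=
    Complex.continuous_ofReal.comp ((continuous_singVal (i.2.trans_le hkn)).comp continuous_fst)
  have hu' (i : Fin k) := continuous_pi_iff.1 hu i
  have hv' (i : Fin k) := continuous_pi_iff.1 hv i
  refine .inter (ho.preimage hu) (.inter (ho.preimage hv)
    (.inter (isClosed_iInter fun i => ?_) (isClosed_iInter fun i => ?_)))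
  · exact isClosed_eq (continuous_fst.toEuclideanLin_apply (hv' i)) ((hs i).smul (hu' i))
  · exact isClosed_eq (continuous_fst.matrix_conjTranspose.toEuclideanLin_apply (hu' i))
      ((hs i).smul (hv' i))

theorem isCompact_singularFrames {n k : ℕ} (hkn : k ≤ n) (A : Matrix (Fin n) (Fin n) ℂ) :
    IsCompact (singularFrames k A) :=
  (isCompact_setOf_orthonormal.prod isCompact_setOf_orthonormal).of_isClosed_subset
    ((isClosed_setOf_mem_singularFrames hkn).preimage (by fun_prop : Continuous fun p => (A, p)))
    fun _ hp => ⟨hp.1, hp.2.1⟩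

theorem continuous_sumOuter {n k : ℕ} :
    Continuous fun p : (Fin k → EuclideanSpace ℂ (Fin n)) × (Fin k → EuclideanSpace ℂ (Fin n)) =>
      sumOuter p.1 p.2 := by
  unfold sumOuter
  fun_prop

/-! ### The two inclusions -/

/-- Subgradients of the Ky Fan norm are dominated in every direction by those coming from
singular frames. -/
theorem exists_singularFrames_re_le {n k : ℕ} (hkn : k ≤ n) {A : Matrix (Fin n) (Fin n) ℂ}
    {φ : Matrix (Fin n) (Fin n) ℂ →L[ℂ] ℂ} (hφ : φ ∈ subdifferential (kyFanNorm k) A)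
    (X : Matrix (Fin n) (Fin n) ℂ) :
    ∃ p ∈ singularFrames k A, (φ X).re ≤ (traceFunctional (sumOuter p.1 p.2) X).re := by
  set t : ℕ → ℝ := fun m => 1 / ((m : ℝ) + 1)
  have ht (m) : 0 < t m := by positivity
  have ht0 : Tendsto t atTop (𝓝 0) := tendsto_one_div_add_atTop_nhds_zero_nat
  choose p hp using fun m => singularFrames_nonempty hkn (A + t m • X)
  have hle (m) : (φ X).re ≤ (traceFunctional (sumOuter (p m).1 (p m).2) X).re := by
    obtain ⟨hu, hv, h, -⟩ := hp m
    have h1 := hφ (A + t m • X)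
    have h2 := traceFunctional_sumOuter_self hu h
    have h3 := traceFunctional_sumOuter_re_le hu hv A
    rw [map_add, Complex.add_re] at h2
    rw [add_sub_cancel_left] at h1
    rw [← Complex.coe_smul, map_smul] at h1 h2
    simp only [smul_eq_mul, Complex.re_ofReal_mul] at h1 h2
    exact le_of_mul_le_mul_left (by linarith) (ht m)
  -- Orthonormal pairs form a compact set, and the singular frame relation is closed jointly in
  -- matrix and frame, so a limit frame belongs to `A`.
  obtain ⟨q, -, θ, hθ, hq⟩ :=
    (isCompact_setOf_orthonormal.prod isCompact_setOf_orthonormal).tendsto_subseq (x := p) fun m => ⟨(hp m).1, (hp m).2.1⟩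
  have hA : Tendsto (fun m => A + t (θ m) • X) atTop (𝓝 A) := by
    simpa using ((ht0.comp hθ.tendsto_atTop).smul_const X).const_add A
  have hqA := (isClosed_setOf_mem_singularFrames hkn).mem_of_tendsto (hA.prodMk_nhds hq)
    (.of_forall fun m => hp (θ m))
  have hlim := ((traceFunctional X).continuous.comp continuous_sumOuter).tendsto q |>.comp hq
  refine ⟨q, hqA, ?_⟩
  rw [re_traceFunctional_comm]
  refine ge_of_tendsto ((Complex.continuous_re.tendsto _).comp hlim) (.of_forall fun m => ?_)
  refine (hle (θ m)).trans_eq ?_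
  rw [re_traceFunctional_comm]
  rfl

theorem traceDual_mem_subdifferential_of_mem_convexHull {n k : ℕ} {A : Matrix (Fin n) (Fin n) ℂ}
    {G : Matrix (Fin n) (Fin n) ℂ} (hG : G ∈ convexHull ℝ
      {G | ∃ u v : Fin k → EuclideanSpace ℂ (Fin n), Orthonormal ℂ u ∧ Orthonormal ℂ v ∧
        (∀ i, Matrix.toEuclideanLin A (v i) = (singVal A i : ℂ) • u i) ∧ G = sumOuter u v}) :
    traceDual n G ∈ subdifferential (kyFanNorm k) A := by
  intro Y
  change _ ≥ (traceFunctional G (Y - A)).re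
  rw [re_traceFunctional_comm]
  -- For fixed `Y` the subgradient inequality cuts out a real half-space in `G`, so only generators
  -- need checking.
  have hconv : Convex ℝ {G | (traceFunctional (Y - A) G).re ≤ kyFanNorm k Y - kyFanNorm k A} :=
    convex_halfSpace_le (f := fun G => (traceFunctional (Y - A) G).re)
      ⟨by simp, fun c G => by rw [← Complex.coe_smul, map_smul]; simp⟩ _
  refine convexHull_min ?_ hconv hG
  rintro _ ⟨u, v, hu, hv, h, rfl⟩
  rw [Set.mem_ofPred_eq, re_traceFunctional_comm, map_sub, Complex.sub_re,
    traceFunctional_sumOuter_self hu h]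
  exact sub_le_sub_right (traceFunctional_sumOuter_re_le hu hv Y) _

theorem subdifferential_kyFanNorm_subset {n k : ℕ} (hkn : k ≤ n) (A : Matrix (Fin n) (Fin n) ℂ) :
    subdifferential (kyFanNorm k) A ⊆
      traceDual n '' convexHull ℝ ((fun p => sumOuter p.1 p.2) '' singularFrames k A) := by
  intro φ hφ
  obtain ⟨G, rfl⟩ := (traceDual n).surjective φ
  refine ⟨G, ?_, rfl⟩
  by_contra hG
  have hcompact :=
    ((isCompact_singularFrames hkn A).image continuous_sumOuter).convexHull_of_finiteDimensional
  have : LocallyConvexSpace ℝ (Matrix (Fin n) (Fin n) ℂ) :=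
    inferInstanceAs (LocallyConvexSpace ℝ (Fin n → Fin n → ℂ))
  -- The separating functional is itself `tr(X* ·)`; its `X` is the direction in which the
  -- domination by frames fails.
  obtain ⟨f, c, hf, hc⟩ := RCLike.geometric_hahn_banach_closed_point (𝕜 := ℂ)
    (convex_convexHull ℝ _) hcompact.isClosed hG
  obtain ⟨X, rfl⟩ := (traceDual n).surjective f
  obtain ⟨p, hp, hle⟩ := exists_singularFrames_re_le hkn hφ X
  have h1 := hf _ (subset_convexHull ℝ _ ⟨p, hp, rfl⟩)
  change (traceFunctional G X).re ≤ _ at hle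
  change (traceFunctional X _).re < c at h1
  change c < (traceFunctional X G).re at hc
  rw [re_traceFunctional_comm] at h1 hc
  linarith

theorem mainTheorem4 (n k : ℕ) (hk : 1 ≤ k) (hkn : k ≤ n) (A : Matrix (Fin n) (Fin n) ℂ) :
    subdifferential (kyFanNorm k) A =
        traceDual n '' convexHull ℝ
          {G | ∃ u v : Fin k → EuclideanSpace ℂ (Fin n), Orthonormal ℂ u ∧ Orthonormal ℂ v ∧
            (∀ i, Matrix.toEuclideanLin A (v i) = (singVal A i : ℂ) • u i) ∧
            G = sumOuter u v} ∧
      subdifferential (kyFanNorm k) A =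
        traceDual n '' convexHull ℝ
          {G | ∃ u v : Fin k → EuclideanSpace ℂ (Fin n), Orthonormal ℂ u ∧ Orthonormal ℂ v ∧
            (∀ i, Matrix.toEuclideanLin A (v i) = (singVal A i : ℂ) • u i) ∧
            (∀ i, Matrix.toEuclideanLin Aᴴ (u i) = (singVal A i : ℂ) • v i) ∧
            G = sumOuter u v} := by
  have hsub := subdifferential_kyFanNorm_subset hkn A
  constructor
  · refine (hsub.trans (Set.image_mono (convexHull_mono ?_))).antisymm ?_
    · rintro _ ⟨⟨u, v⟩, ⟨hu, hv, h, -⟩, rfl⟩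
      exact ⟨u, v, hu, hv, h, rfl⟩
    · rintro _ ⟨G, hG, rfl⟩
      exact traceDual_mem_subdifferential_of_mem_convexHull hG
  · refine (hsub.trans (Set.image_mono (convexHull_mono ?_))).antisymm ?_
    · rintro _ ⟨⟨u, v⟩, ⟨hu, hv, h, h'⟩, rfl⟩
      exact ⟨u, v, hu, hv, h, h', rfl⟩
    · rintro _ ⟨G, hG, rfl⟩
      refine traceDual_mem_subdifferential_of_mem_convexHull (convexHull_mono ?_ hG)
      rintro _ ⟨u, v, hu, hv, h, -, rfl⟩
      exact ⟨u, v, hu, hv, h, rfl⟩
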